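/- Identify subsets of $\omega=\{0,1,2,\dots\}$ with elements of Cantor space $2^\omega$, and let $\mu$ be the uniform (fair coin) measure on $2^\omega$. A set $S\subseteq\omega$ has density $0$ if $\lim_n |S\cap\{0,\dots,n-1\}|/n=0$. A set $D$ is a coarse description of $X$ if the symmetric difference $D\triangle X$ has density $0$, and $X$ is coarsely computable if it has a computable coarse description. A set $A$ is nonuniformly coarsely reducible to $X$ if every coarse description of $X$ computes a coarse description of $A$; it is uniformly coarsely reducible to $X$ if there is a single Turing functional $\Phi$ such that $\Phi^D$ is a coarse description of $A$ for every coarse description $D$ of $X$. The nonuniform (respectively uniform) coarse degrees are the equivalence classes of sets under mutual nonuniform (respectively uniform) coarse reducibility, with the induced partial order; in both structures the least degree $\mathbf 0$ is the degree of $\emptyset$ (which consists of the coarsely computable sets). Two degrees $\mathbf a,\mathbf b$ form a minimal pair if $\mathbf a\neq\mathbf 0$, $\mathbf b\neq\mathbf 0$, and $\mathbf 0$ is the only degree $\mathbf c$ with $\mathbf c\le\mathbf a$ and $\mathbf c\le\mathbf b$. A $\Pi^{0,Y}_3$ class is a class of the form $\{Z\in 2^\omega:\forall a\,\exists b\,\forall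 c\;R(a,b,Z\upharpoonright c)\}$ with $R$ a $Y$-computable relation, where $Z\upharpoonright c$ is the initial segment of $Z$ of length $c$. A set $X$ is weakly $3$-random relative to $Y$ if $X$ belongs to no $\Pi^{0,Y}_3$ class of $\mu$-measure $0$. Theorem. Let $X,Y\subseteq\omega$. If $Y$ is not coarsely computable and $X$ is weakly $3$-random relative to $Y$, then the nonuniform coarse degrees of $X$ and $Y$ form a minimal pair, and the uniform coarse degrees of $X$ and $Y$ form a minimal pair. -/

import Mathlib

open MeasureTheory Filter Topology

namespace CoarseDegrees

/-! A set `A ⊆ ω` is represented by its characteristic function `A : ℕ → Bool`, so that Cantor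
space `2^ω` is the type `ℕ → Bool`. -/

/-! ### Density and coarse descriptions -/

/-- The density `|S ∩ {0, …, n-1}| / n` of `S` below `n`. -/
noncomputable def densityBelow (S : Set ℕ) (n : ℕ) : ℝ :=
  ((S ∩ Set.Iio n).ncard : ℝ) / n

/-- The density of `S` exists and equals `r`. -/
def HasDensity (S : Set ℕ) (r : ℝ) : Prop :=
  Tendsto (densityBelow S) atTop (𝓝 r)

/-- `D` is a coarse description of `X`: the symmetric difference of `D` and `X` has density `0`. -/
def IsCoarseDescription (D X : ℕ → Bool) : Prop :=
  HasDensity {n | D n ≠ X n} 0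

/-- `X` is coarsely computable: it has a computable coarse description. -/
def CoarselyComputable (X : ℕ → Bool) : Prop :=
  ∃ D : ℕ → Bool, Computable D ∧ IsCoarseDescription D X

/-! ### Oracle computations and Turing functionals -/

/-- The `0`-`1`-valued characteristic function of `A`, as an oracle. -/
def oracle (A : ℕ → Bool) : ℕ →. ℕ := fun n => Part.some (A n).toNat

/-- `A` is Turing reducible to `B`, i.e. `B` computes `A`. -/
def Computes (B A : ℕ → Bool) : Prop := TuringReducible (oracle A) (oracle B)

/-- Codes for oracle computations. A code `c` stands for the Turing functional that sends an
oracle `g` to the partial function `c.eval g`. -/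
inductive OracleCode : Type
  | zero : OracleCode
  | succ : OracleCode
  | left : OracleCode
  | right : OracleCode
  | oracle : OracleCode
  | pair : OracleCode → OracleCode → OracleCode
  | comp : OracleCode → OracleCode → OracleCode
  | prec : OracleCode → OracleCode → OracleCode
  | rfind : OracleCode → OracleCode

/-- The partial function computed by a code with oracle `g`; the clauses are those of
`Nat.RecursiveIn`. -/
def OracleCode.eval (g : ℕ →. ℕ) : OracleCode → ℕ →. ℕ
  | .zero => fun _ => Part.some 0
  | .succ => fun n => Part.some (n + 1)
  | .left => fun n => Part.some (Nat.unpair n).1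
  | .right => fun n => Part.some (Nat.unpair n).2
  | .oracle => g
  | .pair c d => fun n => Nat.pair <$> c.eval g n <*> d.eval g n
  | .comp c d => fun n => d.eval g n >>= c.eval g
  | .prec c d => fun p =>
      let (a, n) := Nat.unpair p
      n.rec (c.eval g a) fun y IH => do
        let i ← IH
        d.eval g (Nat.pair a (Nat.pair y i))
  | .rfind c => fun a => Nat.rfind fun n => (fun m => m = 0) <$> c.eval g (Nat.pair a n)

/-- The partial functions computed by codes with oracle `g` are exactly the functions which are
recursive in `g`. -/
theorem OracleCode.exists_eval_iff (g f : ℕ →. ℕ) :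
    (∃ c : OracleCode, c.eval g = f) ↔ TuringReducible f g := by
  unfold TuringReducible
  rw [RecursiveIn.iff_nat]
  constructor
  · rintro ⟨c, rfl⟩
    induction c with
    | zero => exact .zero
    | succ => exact .succ
    | left => exact .left
    | right => exact .right
    | oracle => exact .oracle g rfl
    | pair c d ihc ihd => exact .pair ihc ihd
    | comp c d ihc ihd => exact .comp ihc ihd
    | prec c d ihc ihd => exact .prec ihc ihd
    | rfind c ihc => exact .rfind ihc
  · intro h
    induction h with
    | zero => exact ⟨.zero, rfl⟩
    | succ => exact ⟨.succ, rfl⟩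
    | left => exact ⟨.left, rfl⟩
    | right => exact ⟨.right, rfl⟩
    | oracle g' h => exact ⟨.oracle, h.symm⟩
    | pair _ _ ihf ihh =>
      obtain ⟨c, rfl⟩ := ihf
      obtain ⟨d, rfl⟩ := ihh
      exact ⟨.pair c d, rfl⟩
    | comp _ _ ihf ihh =>
      obtain ⟨c, rfl⟩ := ihf
      obtain ⟨d, rfl⟩ := ihh
      exact ⟨.comp c d, rfl⟩
    | prec _ _ ihf ihh =>
      obtain ⟨c, rfl⟩ := ihf
      obtain ⟨d, rfl⟩ := ihh
      exact ⟨.prec c d, rfl⟩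
    | rfind _ ihf =>
      obtain ⟨c, rfl⟩ := ihf
      exact ⟨.rfind c, rfl⟩

/-- Composition of functionals: every oracle query of `c` is answered by running `e`. -/
def OracleCode.subst (c e : OracleCode) : OracleCode :=
  match c with
  | .zero => .zero
  | .succ => .succ
  | .left => .left
  | .right => .right
  | .oracle => e
  | .pair c d => .pair (c.subst e) (d.subst e)
  | .comp c d => .comp (c.subst e) (d.subst e)
  | .prec c d => .prec (c.subst e) (d.subst e)
  | .rfind c => .rfind (c.subst e)

theorem OracleCode.eval_subst (g : ℕ →. ℕ) (c e : OracleCode) :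
    (c.subst e).eval g = c.eval (e.eval g) := by
  induction c with
  | zero | succ | left | right | oracle => rfl
  | pair c d ihc ihd => simp only [subst, eval, ihc, ihd]; rfl
  | comp c d ihc ihd => simp only [subst, eval, ihc, ihd]; rfl
  | prec c d ihc ihd => simp only [subst, eval, ihc, ihd]; rfl
  | rfind c ihc => simp only [subst, eval, ihc]; rfl

/-! ### Coarse reducibilities -/

/-- `Y` is nonuniformly coarsely reducible to `X`: every coarse description of `X` computes a
coarse description of `Y`. -/
def NonuniformCoarseReducible (Y X : ℕ → Bool) : Prop :=
  ∀ D, IsCoarseDescription D X → ∃ E, IsCoarseDescription E Y ∧ Computes D E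

/-- `Y` is uniformly coarsely reducible to `X`: there is a single Turing functional `Φ` such that
`Φ^D` is (the characteristic function of) a coarse description of `Y` whenever `D` is a coarse
description of `X`. -/
def UniformCoarseReducible (Y X : ℕ → Bool) : Prop :=
  ∃ Φ : OracleCode, ∀ D, IsCoarseDescription D X →
    ∃ E, IsCoarseDescription E Y ∧ Φ.eval (oracle D) = oracle E

theorem IsCoarseDescription.refl (X : ℕ → Bool) : IsCoarseDescription X X := by
  have h : densityBelow {n | X n ≠ X n} = fun _ => 0 := by
    funext n
    simp [densityBelow]
  unfold IsCoarseDescription HasDensity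
  rw [h]
  exact tendsto_const_nhds

instance nonuniform_isPreorder : IsPreorder (ℕ → Bool) NonuniformCoarseReducible where
  refl _ D hD := ⟨D, hD, TuringReducible.refl _⟩
  trans _ _ _ hAB hBC D hD := by
    obtain ⟨E, hE, hDE⟩ := hBC D hD
    obtain ⟨F, hF, hEF⟩ := hAB E hE
    exact ⟨F, hF, TuringReducible.trans hEF hDE⟩

instance uniform_isPreorder : IsPreorder (ℕ → Bool) UniformCoarseReducible where
  refl _ := ⟨.oracle, fun D hD => ⟨D, hD, rfl⟩⟩
  trans _ _ _ hAB hBC := by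
    obtain ⟨Φ, hΦ⟩ := hAB
    obtain ⟨Ψ, hΨ⟩ := hBC
    refine ⟨Φ.subst Ψ, fun D hD => ?_⟩
    obtain ⟨E, hE, hDE⟩ := hΨ D hD
    obtain ⟨F, hF, hEF⟩ := hΦ E hE
    exact ⟨F, hF, by rw [OracleCode.eval_subst, hDE, hEF]⟩

/-! ### Coarse degrees -/

/-- The partial order that a preorder relation `r` induces on its equivalence classes. -/
abbrev degreeOrder {α : Type*} (r : α → α → Prop) [h : IsPreorder α r] :
    PartialOrder (Antisymmetrization α r) where
  le a b := Quotient.liftOn₂' a b r fun _ _ _ _ h₁ h₂ => propext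
    ⟨fun hr => h.trans _ _ _ h₁.2 (h.trans _ _ _ hr h₂.1),
      fun hr => h.trans _ _ _ h₁.1 (h.trans _ _ _ hr h₂.2)⟩
  le_refl a := Quotient.inductionOn' a fun x => h.refl x
  le_trans a b c := Quotient.inductionOn₃' a b c fun x y z => h.trans x y z
  le_antisymm a b := Quotient.inductionOn₂' a b fun _ _ h₁ h₂ => Quotient.sound' ⟨h₁, h₂⟩

/-- The nonuniform coarse degrees: equivalence classes under mutual nonuniform coarse
reducibility. -/
def NonuniformCoarseDegree : Type :=
  Antisymmetrization (ℕ → Bool) NonuniformCoarseReducible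

/-- The uniform coarse degrees: equivalence classes under mutual uniform coarse reducibility. -/
def UniformCoarseDegree : Type :=
  Antisymmetrization (ℕ → Bool) UniformCoarseReducible

/-- The nonuniform coarse degree of a set. -/
def nonuniformDegree (X : ℕ → Bool) : NonuniformCoarseDegree :=
  toAntisymmetrization NonuniformCoarseReducible X

/-- The uniform coarse degree of a set. -/
def uniformDegree (X : ℕ → Bool) : UniformCoarseDegree :=
  toAntisymmetrization UniformCoarseReducible X

/-- The order induced on the nonuniform coarse degrees. -/
instance : PartialOrder NonuniformCoarseDegree :=
  degreeOrder NonuniformCoarseReducible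

/-- The order induced on the uniform coarse degrees. -/
instance : PartialOrder UniformCoarseDegree :=
  degreeOrder UniformCoarseReducible

theorem nonuniformDegree_le_iff (X Y : ℕ → Bool) :
    nonuniformDegree X ≤ nonuniformDegree Y ↔ NonuniformCoarseReducible X Y := Iff.rfl

theorem uniformDegree_le_iff (X Y : ℕ → Bool) :
    uniformDegree X ≤ uniformDegree Y ↔ UniformCoarseReducible X Y := Iff.rfl

theorem empty_uniformCoarseReducible (X : ℕ → Bool) :
    UniformCoarseReducible (fun _ => false) X :=
  ⟨.zero, fun _ _ => ⟨fun _ => false, .refl _, rfl⟩⟩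

theorem UniformCoarseReducible.nonuniform {X Y : ℕ → Bool} (h : UniformCoarseReducible Y X) :
    NonuniformCoarseReducible Y X := by
  obtain ⟨Φ, hΦ⟩ := h
  intro D hD
  obtain ⟨E, hE, h⟩ := hΦ D hD
  exact ⟨E, hE, (OracleCode.exists_eval_iff _ _).1 ⟨Φ, h⟩⟩

/-- The least nonuniform coarse degree is that of the empty set. -/
instance : OrderBot NonuniformCoarseDegree where
  bot := nonuniformDegree fun _ => false
  bot_le a := Quotient.inductionOn' a fun X => (empty_uniformCoarseReducible X).nonuniform

/-- The least uniform coarse degree is that of the empty set. -/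
instance : OrderBot UniformCoarseDegree where
  bot := uniformDegree fun _ => false
  bot_le a := Quotient.inductionOn' a fun X => empty_uniformCoarseReducible X

/-- Two degrees form a minimal pair: both are nonzero, and only the zero degree lies below both
of them. -/
def IsMinimalPair {α : Type*} [PartialOrder α] [OrderBot α] (a b : α) : Prop :=
  a ≠ ⊥ ∧ b ≠ ⊥ ∧ ∀ c, c ≤ a → c ≤ b → c = ⊥

/-! ### Weak `3`-randomness -/

/-- The uniform (fair coin) measure on Cantor space. -/
noncomputable def cantorMeasure : Measure (ℕ → Bool) :=
  Measure.infinitePi fun _ => (PMF.uniformOfFintype Bool).toMeasure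

/-- The initial segment of `X` of length `n`, as a binary string. -/
def initialSegment (X : ℕ → Bool) (n : ℕ) : List Bool := (List.range n).map X

/-- `P` is a `Π⁰₃` class relative to `Y`: for some `Y`-computable relation `R`, a set `Z` is in
`P` iff for all `a` there is `b` such that for all `c`, `R` holds of `a`, `b` and the initial
segment of `Z` of length `c`. -/
def IsPiThreeClassRel (Y : ℕ → Bool) (P : Set (ℕ → Bool)) : Prop :=
  ∃ R : ℕ × ℕ × List Bool → Bool, ComputableIn {oracle Y} R ∧
    P = {Z | ∀ a, ∃ b, ∀ c, R (a, b, initialSegment Z c) = true}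

/-- `X` is weakly `3`-random relative to `Y`: `X` is in no null `Π⁰₃` class relative to `Y`
(equivalently, `X` is in every `Σ⁰₃` class relative to `Y` of measure `1`). -/
def WeaklyThreeRandomRel (X Y : ℕ → Bool) : Prop :=
  ∀ P : Set (ℕ → Bool), IsPiThreeClassRel Y P → cantorMeasure P = 0 → X ∉ P

end CoarseDegrees

namespace CoarseDegrees

/-! Suppose `A` lies below both `X` and `Y`. Then `Y` computes a coarse description `E` of `A`, and
some functional `c` takes `X` to a coarse description of `A`, hence of `E`. The oracles on which `c`
yields a coarse description of `E` form a class `P`. Totality with values 0 and 1 is a `Π₂`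
condition and density 0 is a `Π₃` condition, so `P` is `Π⁰₃` relative to `Y`
(`isPiThreeClassRel_coarseDescriptionClass`). It contains `X`, so weak 3-randomness makes its
measure positive.

Positive measure makes `E` coarsely computable (`coarselyComputable_of_measure_ne_zero`). Choose a
clopen set `C` in which `P` has relative measure above 3/4, and let the oracles in `C` vote: `D n`
is a value that `c` gives on at least 3/8 of `C`. If `D n` is wrong, at least 3/8 - 1/4 = 1/8 of `C`
lies in `P` and gives the wrong answer. Each oracle in `P` errs only on a set of density 0, so by
dominated convergence the average error measure tends to 0, and `D` errs only on a set of density 0.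
Hence `A` is coarsely computable.

That `X` is not coarsely computable is the same method with the identity functional: by the strong
law of large numbers the coarse descriptions of a fixed set form a null class. Uniform reducibility
implies nonuniform reducibility and both zero degrees consist of the coarsely computable sets, so
one argument serves both structures. -/

/-! ### Evaluation of codes on finite oracles -/

/-- Search for a zero of `f` below a bound: the value is `some (v + 1)` if `v` is the first zero,
`some 0` if no zero was found, and `none` if an undefined value was met before a zero. -/
def boundedSearch (f : ℕ → Option ℕ) (k : ℕ) : Option ℕ :=
  k.rec (some 0) fun j ih => ih.bind fun r =>
    bif r.beq 0 then (f j).map fun m => bif m.beq 0 then j + 1 else 0 else some r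

/-- The clauses go through one induction: a new zero at `k` counts as the first only because the
outcome `some 0` certifies positive values before it. -/
theorem boundedSearch_spec (f : ℕ → Option ℕ) (k : ℕ) :
    (boundedSearch f k = some 0 ↔ ∀ j < k, ∃ x, f j = some (x + 1)) ∧
    ∀ v, boundedSearch f k = some (v + 1) ↔
      v < k ∧ f v = some 0 ∧ ∀ j < v, ∃ x, f j = some (x + 1) := by
  induction k with
  | zero => simp [boundedSearch]
  | succ k ih =>
    have hs : boundedSearch f (k + 1) = (boundedSearch f k).bind fun r =>
      bif r.beq 0 then (f k).map fun m => bif m.beq 0 then k + 1 else 0 else some r := rfl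
    obtain ⟨ih0, ihs⟩ := ih
    rw [hs]
    rcases h : boundedSearch f k with _ | _ | w
    · rw [h] at ih0 ihs
      simp only [reduceCtorEq, false_iff] at ih0 ihs
      simp only [Option.bind_none, reduceCtorEq, false_iff]
      refine ⟨fun hk => ih0 fun j hj => hk j (by omega), ?_⟩
      rintro v ⟨hv, h0, hj⟩
      rcases Nat.lt_succ_iff_lt_or_eq.1 hv with hv | rfl
      · exact ihs v ⟨hv, h0, hj⟩
      · exact ih0 hj
    · rw [h] at ih0 ihs
      simp only [true_iff, Option.some.injEq, Nat.right_eq_add, Nat.add_eq_zero_iff, one_ne_zero,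
        and_false, false_iff] at ih0 ihs
      rcases hf : f k with _ | _ | x
      · simp only [Option.bind_some, Nat.beq_refl, cond_true, Option.map_none, reduceCtorEq,
          false_iff]
        refine ⟨fun hk => by simpa [hf] using hk k (by omega), ?_⟩
        rintro v ⟨hv, h0, hj⟩
        rcases Nat.lt_succ_iff_lt_or_eq.1 hv with hv | rfl
        · exact ihs v ⟨hv, h0, hj⟩
        · simp [hf] at h0
      · simp only [Option.bind_some, Nat.beq_refl, cond_true, Option.map_some, Option.some.injEq,
          Nat.add_eq_zero_iff, one_ne_zero, and_false, false_iff, Nat.add_right_cancel_iff]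
        refine ⟨fun hk => by simpa [hf] using hk k (by omega), fun v => ⟨?_, ?_⟩⟩
        · rintro rfl
          exact ⟨by omega, hf, ih0⟩
        · rintro ⟨hv, h0, hj⟩
          rcases Nat.lt_succ_iff_lt_or_eq.1 hv with hv | rfl
          · exact (ihs v ⟨hv, h0, hj⟩).elim
          · rfl
      · have : Nat.beq (x + 1) 0 = false := rfl
        simp only [Option.bind_some, Nat.beq_refl, cond_true, Option.map_some, this, cond_false,
          true_iff, Option.some.injEq, Nat.zero_ne_add_one, false_iff]
        constructor
        · intro j hj
          rcases Nat.lt_succ_iff_lt_or_eq.1 hj with hj | rfl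
          · exact ih0 j hj
          · exact ⟨x, hf⟩
        · rintro v ⟨hv, h0, hj⟩
          obtain ⟨y, hy⟩ : ∃ y, f v = some (y + 1) := by
            rcases Nat.lt_succ_iff_lt_or_eq.1 hv with hv | rfl
            · exact ih0 v hv
            · exact ⟨x, hf⟩
          simp [hy] at h0
    · rw [h] at ih0 ihs
      have : Nat.beq (w + 1) 0 = false := rfl
      obtain ⟨hw, hw0, hwj⟩ := (ihs w).1 rfl
      simp only [Option.bind_some, this, cond_false, Option.some.injEq, Nat.add_eq_zero_iff,
        one_ne_zero, and_false, false_iff, Nat.add_right_cancel_iff]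
      refine ⟨fun hk => ?_, fun v => ⟨?_, ?_⟩⟩
      · obtain ⟨x, hx⟩ := hk w (by omega)
        simp [hw0] at hx
      · rintro rfl
        exact ⟨by omega, hw0, hwj⟩
      · rintro ⟨hv, h0, hj⟩
        rcases lt_trichotomy v w with hvw | hvw | hvw
        · obtain ⟨x, hx⟩ := hwj v hvw
          simp [h0] at hx
        · exact hvw.symm
        · obtain ⟨x, hx⟩ := hj w hvw
          simp [hw0] at hx

/-- Evaluation of a code on a finite oracle. A computation that queries the oracle outside its
domain is undefined, and unbounded searches are cut off at the length of the oracle, so that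
evaluation is total as a function into `Option ℕ`. -/
def OracleCode.evalString : OracleCode → List Bool → ℕ → Option ℕ
  | .zero => fun _ _ => some 0
  | .succ => fun _ n => some (n + 1)
  | .left => fun _ n => some n.unpair.1
  | .right => fun _ n => some n.unpair.2
  | .oracle => fun σ n => σ[n]?.map Bool.toNat
  | .pair c d => fun σ n =>
      (c.evalString σ n).bind fun x => (d.evalString σ n).map fun y => Nat.pair x y
  | .comp c d => fun σ n => (d.evalString σ n).bind fun x => c.evalString σ x
  | .prec c d => fun σ p =>
      p.unpair.2.rec (c.evalString σ p.unpair.1) fun y ih =>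
        ih.bind fun i => d.evalString σ (Nat.pair p.unpair.1 (Nat.pair y i))
  | .rfind c => fun σ a =>
      (boundedSearch (fun k => c.evalString σ (Nat.pair a k)) σ.length).bind fun r =>
        bif r.beq 0 then none else some r.pred

theorem OracleCode.evalString_rfind (c : OracleCode) (σ : List Bool) (a v : ℕ) :
    (OracleCode.rfind c).evalString σ a = some v ↔ v < σ.length ∧
      c.evalString σ (Nat.pair a v) = some 0 ∧
      ∀ j < v, ∃ x, c.evalString σ (Nat.pair a j) = some (x + 1) := by
  rw [← (boundedSearch_spec (fun k => c.evalString σ (Nat.pair a k)) σ.length).2 v]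
  simp only [OracleCode.evalString]
  rcases boundedSearch (fun k => c.evalString σ (Nat.pair a k)) σ.length with _ | _ | w
  · simp
  · simp
  · have : Nat.beq (w + 1) 0 = false := rfl
    simp [this]

theorem primrec_natBeq_zero {α : Type*} [Primcodable α] {f : α → ℕ} (hf : Primrec f) :
    Primrec fun a => (f a).beq 0 :=
  (Primrec.beq.comp hf (Primrec.const 0)).of_eq fun a => by
    cases f a <;> rfl

/-- The code is fixed and only the string and the input vary, so structural induction suffices and
no universal machine is needed. -/
theorem OracleCode.primrec_evalString (c : OracleCode) : Primrec₂ c.evalString := by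
  induction c with
  | zero => exact Primrec.const _
  | succ => exact Primrec.option_some.comp (Primrec.succ.comp Primrec.snd)
  | left => exact Primrec.option_some.comp (Primrec.fst.comp (Primrec.unpair.comp Primrec.snd))
  | right => exact Primrec.option_some.comp (Primrec.snd.comp (Primrec.unpair.comp Primrec.snd))
  | oracle =>
    exact Primrec.option_map Primrec.list_getElem?
      ((Primrec.dom_finite Bool.toNat).comp Primrec.snd).to₂
  | pair c d ihc ihd =>
    have hd : Primrec fun y : (List Bool × ℕ) × ℕ => d.evalString y.1.1 y.1.2 :=
      ihd.comp (Primrec.fst.comp Primrec.fst) (Primrec.snd.comp Primrec.fst)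
    exact Primrec.option_bind ihc (Primrec.option_map hd
      (Primrec₂.natPair.comp (Primrec.snd.comp Primrec.fst) Primrec.snd).to₂).to₂
  | comp c d ihc ihd =>
    exact Primrec.option_bind ihd
      (ihc.comp (Primrec.fst.comp Primrec.fst) Primrec.snd).to₂
  | prec c d ihc ihd =>
    have hu : Primrec fun x : List Bool × ℕ => x.2.unpair := Primrec.unpair.comp Primrec.snd
    have hx : Primrec fun y : ((List Bool × ℕ) × ℕ × Option ℕ) × ℕ => y.1.1 :=
      Primrec.fst.comp Primrec.fst
    have hd : Primrec fun y : ((List Bool × ℕ) × ℕ × Option ℕ) × ℕ =>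
        d.evalString y.1.1.1 (Nat.pair y.1.1.2.unpair.1 (Nat.pair y.1.2.1 y.2)) :=
      ihd.comp (Primrec.fst.comp hx) (Primrec₂.natPair.comp (Primrec.fst.comp (hu.comp hx))
        (Primrec₂.natPair.comp (Primrec.fst.comp (Primrec.snd.comp Primrec.fst)) Primrec.snd))
    have hs : Primrec₂ fun (x : List Bool × ℕ) (y : ℕ × Option ℕ) => y.2.bind fun i =>
        d.evalString x.1 (Nat.pair x.2.unpair.1 (Nat.pair y.1 i)) :=
      Primrec.option_bind (Primrec.snd.comp Primrec.snd) hd.to₂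
    exact (Primrec.nat_rec' (Primrec.snd.comp hu)
      (ihc.comp Primrec.fst (Primrec.fst.comp hu)) hs).to₂
  | rfind c ihc =>
    have hx : Primrec fun y : ((List Bool × ℕ) × ℕ × Option ℕ) × ℕ => y.1.1 :=
      Primrec.fst.comp Primrec.fst
    have hj : Primrec fun y : ((List Bool × ℕ) × ℕ × Option ℕ) × ℕ => y.1.2.1 :=
      Primrec.fst.comp (Primrec.snd.comp Primrec.fst)
    have hc : Primrec fun y : ((List Bool × ℕ) × ℕ × Option ℕ) × ℕ =>
        c.evalString y.1.1.1 (Nat.pair y.1.1.2 y.1.2.1) :=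
      ihc.comp (Primrec.fst.comp hx) (Primrec₂.natPair.comp (Primrec.snd.comp hx) hj)
    have hm : Primrec₂ fun (y : ((List Bool × ℕ) × ℕ × Option ℕ) × ℕ) (m : ℕ) =>
        bif m.beq 0 then y.1.2.1 + 1 else 0 :=
      (Primrec.cond (primrec_natBeq_zero Primrec.snd)
        (Primrec.succ.comp (hj.comp Primrec.fst)) (Primrec.const 0)).to₂
    have hs : Primrec₂ fun (x : List Bool × ℕ) (y : ℕ × Option ℕ) => y.2.bind fun r =>
        bif r.beq 0 then (c.evalString x.1 (Nat.pair x.2 y.1)).map fun m =>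
          bif m.beq 0 then y.1 + 1 else 0 else some r :=
      Primrec.option_bind (Primrec.snd.comp Primrec.snd)
        (Primrec.cond (primrec_natBeq_zero Primrec.snd) (Primrec.option_map hc hm)
          (Primrec.option_some.comp Primrec.snd)).to₂
    have hb : Primrec fun x : List Bool × ℕ =>
        boundedSearch (fun k => c.evalString x.1 (Nat.pair x.2 k)) x.1.length :=
      Primrec.nat_rec' (Primrec.list_length.comp Primrec.fst) (Primrec.const (some 0)) hs
    exact Primrec.option_bind hb (Primrec.cond (primrec_natBeq_zero Primrec.snd)
      (Primrec.const none) (Primrec.option_some.comp (Primrec.pred.comp Primrec.snd))).to₂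

/-! ### Initial segments and the use principle. -/

theorem length_initialSegment (Z : ℕ → Bool) (n : ℕ) : (initialSegment Z n).length = n := by
  simp [initialSegment]

theorem getElem?_initialSegment {Z : ℕ → Bool} {s n : ℕ} (h : n < s) :
    (initialSegment Z s)[n]? = some (Z n) := by
  simp [initialSegment, h]

theorem initialSegment_succ (Z : ℕ → Bool) (n : ℕ) :
    initialSegment Z (n + 1) = initialSegment Z n ++ [Z n] := by
  simp [initialSegment, List.range_succ]

theorem take_initialSegment (Z : ℕ → Bool) {m n : ℕ} (h : m ≤ n) :
    (initialSegment Z n).take m = initialSegment Z m := by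
  simp [initialSegment, ← List.map_take, List.take_range, h]

/-- A computation on an initial segment of `Z` is a computation with oracle `Z`. -/
theorem OracleCode.mem_eval_of_evalString (Z : ℕ → Bool) (s : ℕ) (c : OracleCode) {n v : ℕ}
    (h : c.evalString (initialSegment Z s) n = some v) : v ∈ c.eval (CoarseDegrees.oracle Z) n := by
  induction c generalizing n v with
  | zero | succ | left | right =>
    simp only [evalString, Option.some.injEq] at h
    simp [eval, h]
  | oracle =>
    simp only [evalString, Option.map_eq_some_iff] at h
    obtain ⟨b, hb, rfl⟩ := h
    have hn : n < s := by
      have := (List.getElem?_eq_some_iff.1 hb).1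
      rwa [length_initialSegment] at this
    rw [getElem?_initialSegment hn, Option.some.injEq] at hb
    simp [eval, CoarseDegrees.oracle, hb]
  | pair c d ihc ihd =>
    simp only [evalString, Option.bind_eq_some_iff, Option.map_eq_some_iff] at h
    obtain ⟨x, hx, y, hy, rfl⟩ := h
    simp only [eval, Part.map_eq_map, Seq.seq, Part.mem_bind_iff, Part.mem_map_iff]
    exact ⟨_, ⟨x, ihc hx, rfl⟩, y, ihd hy, rfl⟩
  | comp c d ihc ihd =>
    simp only [evalString, Option.bind_eq_some_iff] at h
    obtain ⟨x, hx, hy⟩ := h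
    exact Part.mem_bind_iff.2 ⟨x, ihd hx, ihc hy⟩
  | prec c d ihc ihd =>
    simp only [evalString] at h
    simp only [eval]
    generalize n.unpair.1 = a at h ⊢
    generalize n.unpair.2 = k at h ⊢
    induction k generalizing v with
    | zero => exact ihc h
    | succ k ih =>
      obtain ⟨i, hi, hd⟩ := Option.bind_eq_some_iff.1 h
      exact Part.mem_bind_iff.2 ⟨i, ih hi, ihd hd⟩
  | rfind c ihc =>
    obtain ⟨-, h0, hj⟩ := (evalString_rfind _ _ _ _).1 h
    refine Nat.mem_rfind.2 ⟨?_, fun {j} hjv => ?_⟩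
    · exact (Part.mem_map_iff _).2 ⟨0, ihc h0, by simp⟩
    · obtain ⟨x, hx⟩ := hj j hjv
      exact (Part.mem_map_iff _).2 ⟨x + 1, ihc hx, by simp⟩

/-- The use principle: a computation with oracle `Z` is a computation on all sufficiently long
initial segments of `Z`. -/
theorem OracleCode.eventually_evalString (Z : ℕ → Bool) (c : OracleCode) {n v : ℕ}
    (h : v ∈ c.eval (CoarseDegrees.oracle Z) n) :
    ∀ᶠ s in atTop, c.evalString (initialSegment Z s) n = some v := by
  induction c generalizing n v with
  | zero | succ | left | right =>
    simp only [eval, Part.mem_some_iff] at h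
    simp [evalString, h]
  | oracle =>
    simp only [eval, CoarseDegrees.oracle, Part.mem_some_iff] at h
    filter_upwards [eventually_gt_atTop n] with s hs
    simp [evalString, getElem?_initialSegment hs, h]
  | pair c d ihc ihd =>
    simp only [eval, Part.map_eq_map, Seq.seq, Part.mem_bind_iff, Part.mem_map_iff] at h
    obtain ⟨_, ⟨x, hx, rfl⟩, y, hy, rfl⟩ := h
    filter_upwards [ihc hx, ihd hy] with s h1 h2
    simp [evalString, h1, h2]
  | comp c d ihc ihd =>
    obtain ⟨x, hx, hy⟩ := Part.mem_bind_iff.1 h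
    filter_upwards [ihd hx, ihc hy] with s h1 h2
    simp [evalString, h1, h2]
  | prec c d ihc ihd =>
    simp only [eval] at h
    simp only [evalString]
    generalize n.unpair.1 = a at h ⊢
    generalize n.unpair.2 = k at h ⊢
    induction k generalizing v with
    | zero => exact ihc h
    | succ k ih =>
      obtain ⟨i, hi, hd⟩ := Part.mem_bind_iff.1 h
      filter_upwards [ih hi, ihd hd] with s h1 h2
      exact Option.bind_eq_some_iff.2 ⟨i, h1, h2⟩
  | rfind c ihc =>
    obtain ⟨h0, hj⟩ := Nat.mem_rfind.1 h
    have h0' : 0 ∈ c.eval (CoarseDegrees.oracle Z) (Nat.pair n v) := by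
      obtain ⟨m, hm, hm0⟩ := (Part.mem_map_iff _).1 h0
      rwa [of_decide_eq_true hm0] at hm
    have hj' : ∀ j < v, ∃ x, x + 1 ∈ c.eval (CoarseDegrees.oracle Z) (Nat.pair n j) := by
      intro j hjv
      obtain ⟨m, hm, hm0⟩ := (Part.mem_map_iff _).1 (hj hjv)
      obtain ⟨x, rfl⟩ := Nat.exists_eq_succ_of_ne_zero (of_decide_eq_false hm0)
      exact ⟨x, hm⟩
    choose! x hx using hj'
    have hev : ∀ᶠ s in atTop, ∀ j ∈ Finset.range v,
        c.evalString (initialSegment Z s) (Nat.pair n j) = some (x j + 1) :=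
      (Filter.eventually_all_finset _).2 fun j hj => ihc (hx j (Finset.mem_range.1 hj))
    filter_upwards [ihc h0', hev, eventually_gt_atTop v] with s h1 h2 h3
    refine (evalString_rfind _ _ _ _).2 ⟨by rwa [length_initialSegment], h1, fun j hj => ?_⟩
    exact ⟨x j, h2 j (Finset.mem_range.2 hj)⟩

/-! ### Relations computable in an oracle -/

theorem recursiveIn_initialSegment (E : ℕ → Bool) :
    Nat.RecursiveIn {oracle E} fun n => Part.some (Encodable.encode (initialSegment E n)) := by
  -- One step of the recursion: decode a string and append the bit just read from the oracle.
  let g : ℕ → ℕ := fun w => Encodable.encode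
    (((Encodable.decode (α := List Bool) w.unpair.1).getD []) ++ [decide (w.unpair.2 = 1)])
  have hg : Nat.RecursiveIn {oracle E} (fun n => Part.some (g n)) := by
    refine Nat.Primrec.recursiveIn (Primrec.nat_iff.1 (Primrec.encode.comp
      (Primrec.list_concat.comp (Primrec.option_getD.comp
        (Primrec.decode.comp (Primrec.fst.comp Primrec.unpair)) (Primrec.const []))
        (Primrec.eq.comp (Primrec.snd.comp Primrec.unpair) (Primrec.const 1)).decide)))
  have hstep : Nat.RecursiveIn {oracle E} fun w : ℕ =>
      Part.some (g (Nat.pair w.unpair.2.unpair.2 (E w.unpair.2.unpair.1).toNat)) := by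
    have h1 : Nat.RecursiveIn {oracle E} fun w : ℕ => Part.some w.unpair.2.unpair.2 :=
      Nat.Primrec.recursiveIn (Nat.Primrec.right.comp Nat.Primrec.right)
    have h2 : Nat.RecursiveIn {oracle E} fun w : ℕ => Part.some w.unpair.2.unpair.1 :=
      Nat.Primrec.recursiveIn (Nat.Primrec.left.comp Nat.Primrec.right)
    have h3 : Nat.RecursiveIn {oracle E} fun w : ℕ => Part.some (E w.unpair.2.unpair.1).toNat :=
      ((Nat.RecursiveIn.oracle (oracle E) (Set.mem_singleton _)).comp h2).of_eq fun w =>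
        Part.bind_some _ _
    exact (hg.comp (h1.pair h3)).of_eq fun w => by simp [Seq.seq]
  have h0 : Nat.RecursiveIn {oracle E} fun _ => Part.some (Encodable.encode ([] : List Bool)) :=
    Nat.Primrec.recursiveIn (Nat.Primrec.const _)
  have hp : Nat.RecursiveIn {oracle E} fun n : ℕ => Part.some (Nat.pair 0 n) :=
    Nat.Primrec.recursiveIn (Nat.Primrec.pair (Nat.Primrec.const 0) Nat.Primrec.id)
  refine ((h0.prec hstep).comp hp).of_eq fun n => ?_
  simp only [Part.bind_eq_bind, Part.bind_some, Nat.unpair_pair]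
  induction n with
  | zero => rfl
  | succ n ih =>
    refine (congrArg (Part.bind · _) ih).trans ?_
    simp only [Part.bind_some, g, Nat.unpair_pair, initialSegment_succ, Encodable.encodek,
      Option.getD_some]
    cases E n <;> rfl

/-- A relation that is primitive recursive given an initial segment of `E` of primitive recursive
length is computable in every `Y` that computes `E`. -/
theorem Computes.computableIn {Y E : ℕ → Bool} (h : Computes Y E) {β : Type*} [Primcodable β]
    {f : β → ℕ} (hf : Primrec f) {g : β → List Bool → Bool} (hg : Primrec₂ g) :
    ComputableIn {oracle Y} fun x => g x (initialSegment E (f x)) := by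
  have hE : RecursiveIn {oracle E} fun x => Part.some (g x (initialSegment E (f x))) := by
    -- The default 0 is harmless, since `p` is undefined at numbers that code no element of `β`.
    let f' : ℕ → ℕ := fun n => ((Encodable.decode (α := β) n).map f).getD 0
    let p : ℕ → Option Bool := fun w => (Encodable.decode (α := β) w.unpair.1).bind fun x =>
      (Encodable.decode (α := List Bool) w.unpair.2).map fun l => g x l
    have hf' : Nat.RecursiveIn {oracle E} fun n => Part.some (f' n) :=
      Nat.Primrec.recursiveIn (Primrec.nat_iff.1 (Primrec.option_getD.comp
        (Primrec.option_map Primrec.decode (hf.comp Primrec.snd).to₂) (Primrec.const 0)))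
    have hp : Primrec p := by
      refine Primrec.option_bind (Primrec.decode.comp (Primrec.fst.comp Primrec.unpair))
        (Primrec.option_map
          (Primrec.decode.comp (Primrec.snd.comp (Primrec.unpair.comp Primrec.fst)))
          (hg.comp (Primrec.snd.comp Primrec.fst) Primrec.snd).to₂).to₂
    have hp' : Nat.RecursiveIn {oracle E} fun w => ((p w : Part Bool)).map Encodable.encode :=
      (RecursiveIn.iff_nat.1
        (Partrec.recursiveIn (hp.to_comp.ofOption.map (Computable.encode.comp Computable.snd).to₂)))
    have hid : Nat.RecursiveIn {oracle E} fun n : ℕ => Part.some n :=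
      Nat.Primrec.recursiveIn Nat.Primrec.id
    refine (hp'.comp (hid.pair ((recursiveIn_initialSegment E).comp hf'))).of_eq fun n => ?_
    rcases hn : Encodable.decode (α := β) n with _ | x
    · simp [Seq.seq, p, hn]
    · simp [Seq.seq, p, hn, f']
  exact hE.subst fun g' hg' => by rw [Set.mem_singleton_iff.1 hg']; exact h

/-! ### Density zero -/

theorem ncard_inter_Iio (S : Set ℕ) (p : ℕ → Bool) (h : ∀ n, p n = true ↔ n ∈ S) (m : ℕ) :
    (S ∩ Set.Iio m).ncard = ((List.range m).filter p).length := by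
  have hS : S ∩ Set.Iio m = ((Finset.range m).filter fun n => p n = true : Finset ℕ) := by
    ext n
    simp [h, and_comm]
  rw [hS, Set.ncard_coe_finset]
  simp [Finset.card, Finset.filter, Finset.range, Multiset.range]

/-- Clearing denominators gives the purely arithmetical `∀∃∀` form from which the `Π⁰₃` definition
is built. -/
theorem hasDensity_zero_iff (S : Set ℕ) :
    HasDensity S 0 ↔ ∀ k : ℕ, ∃ N, ∀ m ≥ N, (k + 1) * (S ∩ Set.Iio m).ncard ≤ m := by
  unfold HasDensity
  rw [Metric.tendsto_atTop]
  constructor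
  · intro h k
    obtain ⟨N, hN⟩ := h (1 / ((k : ℝ) + 1)) (by positivity)
    refine ⟨N + 1, fun m hm => ?_⟩
    have := hN m (by omega)
    have hm0 : (0 : ℝ) < m := by exact_mod_cast (by omega : 0 < m)
    rw [Real.dist_eq, sub_zero, abs_of_nonneg (by unfold densityBelow; positivity), densityBelow,
      div_lt_div_iff₀ hm0 (by positivity)] at this
    have h2 : (((k + 1) * (S ∩ Set.Iio m).ncard : ℕ) : ℝ) ≤ m := by
      push_cast
      linarith
    exact_mod_cast h2
  · intro h ε hε
    obtain ⟨k, hk⟩ := exists_nat_one_div_lt hε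
    obtain ⟨N, hN⟩ := h k
    refine ⟨N, fun m hm => ?_⟩
    rw [Real.dist_eq, sub_zero, abs_of_nonneg (by unfold densityBelow; positivity), densityBelow]
    refine lt_of_le_of_lt ?_ hk
    have h2 : (((k + 1) * (S ∩ Set.Iio m).ncard : ℕ) : ℝ) ≤ m := by exact_mod_cast hN m hm
    push_cast at h2
    rcases Nat.eq_zero_or_pos m with rfl | hm0
    · simp
      positivity
    · rw [div_le_div_iff₀ (by exact_mod_cast hm0) (by positivity)]
      linarith

theorem IsCoarseDescription.symm {D E : ℕ → Bool} (h : IsCoarseDescription D E) :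
    IsCoarseDescription E D := by
  unfold IsCoarseDescription at *
  simpa only [ne_comm] using h

theorem IsCoarseDescription.trans {D E F : ℕ → Bool} (h₁ : IsCoarseDescription D E)
    (h₂ : IsCoarseDescription E F) : IsCoarseDescription D F := by
  unfold IsCoarseDescription HasDensity at *
  have h := h₁.add h₂
  rw [add_zero] at h
  refine squeeze_zero (fun n => by unfold densityBelow; positivity) (fun n => ?_) h
  unfold densityBelow
  rw [← add_div]
  gcongr
  norm_cast
  refine (Set.ncard_le_ncard ?_ ((Set.finite_Iio n).inter_of_right _ |>.union
    ((Set.finite_Iio n).inter_of_right _))).trans (Set.ncard_union_le _ _)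
  rintro i ⟨hi, hn⟩
  by_cases hDE : D i = E i
  · exact Or.inr ⟨by simpa [hDE] using hi, hn⟩
  · exact Or.inl ⟨hDE, hn⟩

/-! ### Computing a coarse description is a `Π⁰₃` property of the oracle -/

/-- The oracles `Z` for which the functional `c` yields a coarse description of `E`. -/
def coarseDescriptionClass (c : OracleCode) (E : ℕ → Bool) : Set (ℕ → Bool) :=
  {Z | ∃ D, c.eval (oracle Z) = oracle D ∧ IsCoarseDescription D E}

/-- On input `n` the code `c` with finite oracle `σ` gives a value different from `α n`. -/
abbrev OracleCode.Disagrees (c : OracleCode) (n : ℕ) (σα : List Bool × List Bool) : Prop :=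
  ((c.evalString σα.1 n).bind fun v => σα.2[n]?.map fun b => !(v == b.toNat)) = some true

theorem OracleCode.disagrees_iff {c : OracleCode} {σ : List Bool} {E : ℕ → Bool} {n s : ℕ}
    (h : n < s) : c.Disagrees n (σ, initialSegment E s) ↔
      ∃ v, c.evalString σ n = some v ∧ v ≠ (E n).toNat := by
  simp [OracleCode.Disagrees, getElem?_initialSegment h, Option.bind_eq_some_iff]

theorem OracleCode.primrecRel_disagrees (c : OracleCode) : PrimrecRel c.Disagrees := by
  have hα : Primrec fun y : (ℕ × List Bool × List Bool) × ℕ => y.1.2.2[y.1.1]? :=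
    Primrec.list_getElem?.comp (Primrec.snd.comp (Primrec.snd.comp Primrec.fst))
      (Primrec.fst.comp Primrec.fst)
  have hb : Primrec₂ fun (y : (ℕ × List Bool × List Bool) × ℕ) (b : Bool) => !(y.2 == b.toNat) :=
    (Primrec.not.comp (Primrec.beq.comp (Primrec.snd.comp Primrec.fst)
      ((Primrec.dom_bool Bool.toNat).comp Primrec.snd))).to₂
  have he : Primrec fun x : ℕ × List Bool × List Bool => c.evalString x.2.1 x.1 :=
    c.primrec_evalString.comp (Primrec.fst.comp Primrec.snd) Primrec.fst
  exact Primrec.eq.comp (Primrec.option_bind he (Primrec.option_map hα hb).to₂)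
    (Primrec.const (some true))

/-- The number of inputs below `m` at which `c` with finite oracle `σ` is seen to differ
from `α`. -/
def OracleCode.disagreements (c : OracleCode) (m : ℕ) (σα : List Bool × List Bool) : ℕ :=
  ((List.range m).filter fun n => c.Disagrees n σα).length

theorem OracleCode.primrec_disagreements (c : OracleCode) : Primrec₂ c.disagreements :=
  Primrec.list_length.comp
    (c.primrecRel_disagrees.listFilter.comp (Primrec.list_range.comp Primrec.fst) Primrec.snd)

/-- The matrix of the `Π⁰₃` definition of `coarseDescriptionClass c E`, where `α` is an initial
segment of `E`. -/
abbrev OracleCode.matrix (c : OracleCode) (x : ℕ × ℕ × List Bool) (α : List Bool) : Prop :=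
  (x.2.2.length < x.2.1.unpair.1 ∨
    c.evalString (x.2.2.take x.2.1.unpair.1) x.1.unpair.1 = some 0 ∨
    c.evalString (x.2.2.take x.2.1.unpair.1) x.1.unpair.1 = some 1) ∧
  (x.2.2.length.unpair.1 < x.2.1.unpair.2 ∨
    (x.1.unpair.2 + 1) * c.disagreements x.2.2.length.unpair.1 (x.2.2, α) ≤
      x.2.2.length.unpair.1)

theorem OracleCode.primrecRel_matrix (c : OracleCode) : PrimrecRel c.matrix := by
  have ha : Primrec fun y : (ℕ × ℕ × List Bool) × List Bool => y.1.1.unpair :=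
    Primrec.unpair.comp (Primrec.fst.comp Primrec.fst)
  have hb : Primrec fun y : (ℕ × ℕ × List Bool) × List Bool => y.1.2.1.unpair :=
    Primrec.unpair.comp (Primrec.fst.comp (Primrec.snd.comp Primrec.fst))
  have hσ : Primrec fun y : (ℕ × ℕ × List Bool) × List Bool => y.1.2.2 :=
    Primrec.snd.comp (Primrec.snd.comp Primrec.fst)
  have hl : Primrec fun y : (ℕ × ℕ × List Bool) × List Bool => y.1.2.2.length :=
    Primrec.list_length.comp hσ
  have hm : Primrec fun y : (ℕ × ℕ × List Bool) × List Bool => y.1.2.2.length.unpair.1 :=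
    Primrec.fst.comp (Primrec.unpair.comp hl)
  have he : Primrec fun y : (ℕ × ℕ × List Bool) × List Bool =>
      c.evalString (y.1.2.2.take y.1.2.1.unpair.1) y.1.1.unpair.1 :=
    c.primrec_evalString.comp (Primrec.list_take.comp (Primrec.fst.comp hb) hσ)
      (Primrec.fst.comp ha)
  refine PrimrecPred.and (PrimrecPred.or (Primrec.nat_lt.comp hl (Primrec.fst.comp hb))
    (PrimrecPred.or (Primrec.eq.comp he (Primrec.const _)) (Primrec.eq.comp he (Primrec.const _))))
    (PrimrecPred.or (Primrec.nat_lt.comp hm (Primrec.snd.comp hb)) (Primrec.nat_le.comp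
      (Primrec.nat_mul.comp (Primrec.succ.comp (Primrec.snd.comp ha))
        (c.primrec_disagreements.comp hm (Primrec.pair hσ Primrec.snd))) hm))

theorem toNat_mem_of_eval_eq {c : OracleCode} {Z D : ℕ → Bool}
    (h : c.eval (oracle Z) = oracle D) (n : ℕ) : (D n).toNat ∈ c.eval (oracle Z) n := by
  rw [h]
  exact Part.mem_some _

/-- Finite computations report only true values of the functional, so disagreements seen on a prefix
can only undercount. -/
theorem OracleCode.disagreements_le {c : OracleCode} {Z D E : ℕ → Bool}
    (h : c.eval (CoarseDegrees.oracle Z) = CoarseDegrees.oracle D) {m s t : ℕ} (hm : m ≤ t) :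
    c.disagreements m (initialSegment Z s, initialSegment E t) ≤
      ({n | D n ≠ E n} ∩ Set.Iio m).ncard := by
  rw [ncard_inter_Iio _ (fun n => decide (D n ≠ E n)) (by simp), disagreements]
  simp only [← List.countP_eq_length_filter]
  refine List.countP_mono_left fun n hn hd => ?_
  rw [decide_eq_true_iff, disagrees_iff ((List.mem_range.1 hn).trans_le hm)] at hd
  obtain ⟨v, hv, hvE⟩ := hd
  have := Part.mem_unique (c.mem_eval_of_evalString Z s hv) (toNat_mem_of_eval_eq h n)
  rw [decide_eq_true_iff]
  rintro hDE
  exact hvE (by rw [this, hDE])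

theorem OracleCode.ncard_le_disagreements {c : OracleCode} {Z D E : ℕ → Bool} {m s t : ℕ}
    (h : ∀ n < m, c.evalString (initialSegment Z s) n = some (D n).toNat) (hm : m ≤ t) :
    ({n | D n ≠ E n} ∩ Set.Iio m).ncard ≤
      c.disagreements m (initialSegment Z s, initialSegment E t) := by
  rw [ncard_inter_Iio _ (fun n => decide (D n ≠ E n)) (by simp), disagreements]
  simp only [← List.countP_eq_length_filter]
  refine List.countP_mono_left fun n hn hd => ?_
  have hnm := List.mem_range.1 hn
  rw [decide_eq_true_iff, disagrees_iff (hnm.trans_le hm)]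
  refine ⟨_, h n hnm, fun heq => of_decide_eq_true hd ?_⟩
  revert heq
  cases D n <;> cases E n <;> simp

/-- Pairing merges two conditions into one quantifier prefix. With `a` coding `(n, k)` and `b`
coding `(s₀, N)`, the first conjunct says that the prefix of length `s₀` yields 0 or 1 at `n`; the
second bounds the disagreements below every `m ≥ N` by `m / (k + 1)`. The length `s` codes `m` as
its first component, so ranging over `s` gives every `m` with arbitrarily long prefixes. -/
theorem coarseDescriptionClass_eq (c : OracleCode) (E : ℕ → Bool) :
    coarseDescriptionClass c E =
      {Z | ∀ a, ∃ b, ∀ s, c.matrix (a, b, initialSegment Z s) (initialSegment E s)} := by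
  ext Z
  simp only [coarseDescriptionClass, Set.mem_ofPred_eq, OracleCode.matrix, length_initialSegment]
  constructor
  · rintro ⟨D, hD, hDE⟩ a
    obtain ⟨s₀, hs₀⟩ :=
      (c.eventually_evalString Z (toNat_mem_of_eval_eq hD a.unpair.1)).exists
    obtain ⟨N, hN⟩ := (hasDensity_zero_iff _).1 hDE a.unpair.2
    refine ⟨Nat.pair s₀ N, fun s => ?_⟩
    simp only [Nat.unpair_pair]
    refine ⟨(lt_or_ge s s₀).imp_right fun hs => ?_, (lt_or_ge _ N).imp_right fun hs => ?_⟩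
    · rw [take_initialSegment Z hs, hs₀]
      cases D a.unpair.1 <;> simp
    · exact (Nat.mul_le_mul_left _
        (OracleCode.disagreements_le hD (Nat.unpair_left_le s))).trans (hN _ hs)
  · intro h
    have hval : ∀ n, ∃ v : Bool, v.toNat ∈ c.eval (oracle Z) n := by
      intro n
      obtain ⟨b, hb⟩ := h (Nat.pair n 0)
      -- At exactly this length the escape clause of the matrix fails, which forces a value.
      have := (hb b.unpair.1).1
      rw [Nat.unpair_pair, take_initialSegment Z le_rfl] at this
      rcases this with h | h | h
      · exact (lt_irrefl _ h).elim
      · exact ⟨false, c.mem_eval_of_evalString Z _ h⟩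
      · exact ⟨true, c.mem_eval_of_evalString Z _ h⟩
    choose D hD using hval
    refine ⟨D, funext fun n => Part.eq_some_iff.2 (hD n), (hasDensity_zero_iff _).2 fun k => ?_⟩
    obtain ⟨b, hb⟩ := h (Nat.pair 0 k)
    refine ⟨b.unpair.2, fun m hm => ?_⟩
    have hev : ∀ᶠ s in atTop, ∀ n ∈ Finset.range m,
        c.evalString (initialSegment Z s) n = some (D n).toNat :=
      (Filter.eventually_all_finset _).2 fun n _ => c.eventually_evalString Z (hD n)
    obtain ⟨t, ht⟩ := eventually_atTop.1 hev
    -- The length `Nat.pair m t` selects `m` and is at least `t`, so all values below `m` are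
    -- visible and the disagreement count is no longer too small.
    have hs := (hb (Nat.pair m t)).2
    simp only [Nat.unpair_pair] at hs
    refine (Nat.mul_le_mul_left _ (OracleCode.ncard_le_disagreements (s := Nat.pair m t)
      (t := Nat.pair m t) (fun n hn => ?_) (Nat.left_le_pair m t))).trans
      (hs.resolve_left (not_lt.2 hm))
    exact ht _ (Nat.right_le_pair m t) n (Finset.mem_range.2 hn)

theorem isPiThreeClassRel_coarseDescriptionClass (c : OracleCode) {Y E : ℕ → Bool}
    (h : Computes Y E) : IsPiThreeClassRel Y (coarseDescriptionClass c E) := by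
  refine ⟨_, h.computableIn (f := fun x : ℕ × ℕ × List Bool => x.2.2.length)
    (Primrec.list_length.comp (Primrec.snd.comp Primrec.snd)) c.primrecRel_matrix.decide, ?_⟩
  rw [coarseDescriptionClass_eq]
  simp only [length_initialSegment, decide_eq_true_iff]

/-! ### The measure of clopen sets -/

instance : IsProbabilityMeasure cantorMeasure := by
  unfold cantorMeasure
  infer_instance

theorem isOpen_setOf_initialSegment (p : List Bool → Prop) (m : ℕ) :
    IsOpen {Z | p (initialSegment Z m)} := by
  have h : {Z : ℕ → Bool | p (initialSegment Z m)} =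
      (fun Z (i : Fin m) => Z i) ⁻¹' {w | p (List.ofFn w)} := by
    ext Z
    simp [initialSegment, List.ofFn_eq_map, ← List.map_coe_finRange_eq_range, List.map_map,
      Function.comp_def]
  rw [h]
  exact (isOpen_discrete _).preimage (by fun_prop)

theorem measurableSet_setOf_initialSegment (p : List Bool → Prop) (m : ℕ) :
    MeasurableSet {Z | p (initialSegment Z m)} :=
  (isOpen_setOf_initialSegment p m).measurableSet

theorem IsPiThreeClassRel.measurableSet {Y : ℕ → Bool} {P : Set (ℕ → Bool)}
    (h : IsPiThreeClassRel Y P) : MeasurableSet P := by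
  obtain ⟨R, -, rfl⟩ := h
  have : {Z | ∀ a, ∃ b, ∀ c, R (a, b, initialSegment Z c) = true} =
      ⋂ a, ⋃ b, ⋂ c, {Z | R (a, b, initialSegment Z c) = true} := by
    ext Z
    simp
  rw [this]
  exact .iInter fun a => .iUnion fun b => .iInter fun c =>
    measurableSet_setOf_initialSegment (fun σ => R (a, b, σ) = true) c

theorem initialSegment_eq_iff (Z : ℕ → Bool) (ρ : List Bool) :
    initialSegment Z ρ.length = ρ ↔ ∀ i (h : i < ρ.length), Z i = ρ[i] := by
  rw [List.ext_getElem_iff]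
  simp [initialSegment]

theorem uniform_bool_singleton (b : Bool) :
    (PMF.uniformOfFintype Bool).toMeasure {b} = 2⁻¹ := by
  rw [PMF.toMeasure_apply_singleton _ _ (MeasurableSet.singleton b)]
  simp

theorem cantorMeasure_initialSegment_eq (ρ : List Bool) :
    cantorMeasure.real {Z | initialSegment Z ρ.length = ρ} = (1 / 2) ^ ρ.length := by
  have h : {Z | initialSegment Z ρ.length = ρ} =
      Set.pi (Finset.range ρ.length : Set ℕ) fun i => {ρ.getD i false} := by
    ext Z
    simp only [Set.mem_ofPred_eq, initialSegment_eq_iff, Set.mem_pi, Finset.coe_range, Set.mem_Iio,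
      Set.mem_singleton_iff]
    refine forall_congr' fun i => forall_congr' fun hi => ?_
    simp [hi]
  rw [h, measureReal_def, cantorMeasure, Measure.infinitePi_pi _ fun _ _ => .singleton _]
  simp only [uniform_bool_singleton, Finset.prod_const, Finset.card_range, ENNReal.toReal_pow,
    ENNReal.toReal_inv, ENNReal.toReal_ofNat, one_div]

/-! ### Measures of clopen sets by counting strings. -/

/-- The list of all binary strings of length `m`. -/
def binaryStrings (m : ℕ) : List (List Bool) :=
  m.rec [[]] fun _ ih => ih.flatMap fun ρ => [ρ ++ [false], ρ ++ [true]]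

theorem binaryStrings_succ (m : ℕ) :
    binaryStrings (m + 1) = (binaryStrings m).flatMap fun ρ => [ρ ++ [false], ρ ++ [true]] := rfl

theorem mem_binaryStrings {m : ℕ} {ρ : List Bool} : ρ ∈ binaryStrings m ↔ ρ.length = m := by
  induction m generalizing ρ with
  | zero => simp [binaryStrings]
  | succ m ih =>
    simp only [binaryStrings_succ, List.mem_flatMap, ih, List.mem_cons, List.not_mem_nil, or_false]
    constructor
    · rintro ⟨τ, rfl, rfl | rfl⟩ <;> simp
    · intro h
      have hne : ρ ≠ [] := by
        rintro rfl
        simp at h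
      obtain ⟨τ, b, rfl⟩ := (List.eq_nil_or_concat ρ).resolve_left hne
      refine ⟨τ, by simpa using h, ?_⟩
      cases b <;> simp

theorem nodup_binaryStrings (m : ℕ) : (binaryStrings m).Nodup := by
  induction m with
  | zero => simp [binaryStrings]
  | succ m ih =>
    rw [binaryStrings_succ, List.nodup_flatMap]
    refine ⟨fun ρ _ => by simp, ih.imp fun {ρ τ} hne => ?_⟩
    simp only [Function.onFun, List.disjoint_left, List.mem_cons, List.not_mem_nil, or_false]
    rintro x (rfl | rfl) (h | h) <;> simp_all

theorem primrec_binaryStrings : Primrec binaryStrings := by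
  have hc : ∀ b : Bool, Primrec fun y : (ℕ × List (List Bool)) × List Bool => y.2 ++ [b] :=
    fun b => Primrec.list_concat.comp Primrec.snd (Primrec.const b)
  exact Primrec.nat_rec₁ [[]] (Primrec.list_flatMap Primrec.snd
    (Primrec.list_cons.comp (hc false) (Primrec.list_cons.comp (hc true)
      (Primrec.const []))).to₂).to₂

theorem cantorMeasure_setOf_initialSegment (p : List Bool → Bool) (m : ℕ) :
    cantorMeasure.real {Z | p (initialSegment Z m) = true} =
      ((binaryStrings m).filter p).length / 2 ^ m := by
  have h : {Z | p (initialSegment Z m) = true} =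
      ⋃ ρ ∈ ((binaryStrings m).filter p).toFinset, {Z | initialSegment Z m = ρ} := by
    ext Z
    simp only [Set.mem_ofPred_eq, List.mem_toFinset, List.mem_filter, Set.mem_iUnion, exists_prop]
    refine ⟨fun h => ⟨_, ⟨mem_binaryStrings.2 (length_initialSegment Z m), h⟩, rfl⟩, ?_⟩
    rintro ⟨ρ, ⟨-, h⟩, rfl⟩
    exact h
  rw [h, measureReal_biUnion_finset]
  · rw [Finset.sum_congr rfl (g := fun _ => (1 / 2 : ℝ) ^ m), Finset.sum_const,
      List.toFinset_card_of_nodup ((nodup_binaryStrings m).filter p)]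
    · simp [div_eq_mul_inv]
    · intro ρ hρ
      obtain rfl := mem_binaryStrings.1 (List.mem_filter.1 (List.mem_toFinset.1 hρ)).1
      exact cantorMeasure_initialSegment_eq ρ
  · intro ρ _ τ _ hne
    exact Set.disjoint_left.2 fun Z h1 h2 => hne (Eq.trans (Eq.symm h1) h2)
  · exact fun ρ _ => measurableSet_setOf_initialSegment (fun σ => σ = ρ) m

/-! ### Approximation of positive-measure sets by clopen sets. -/

theorem exists_lt_measureReal_of_iUnion {A : ℕ → Set (ℕ → Bool)} (hA : Monotone A) {r : ℝ}
    (h : r < cantorMeasure.real (⋃ n, A n)) : ∀ᶠ n in atTop, r < cantorMeasure.real (A n) := by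
  have := (ENNReal.tendsto_toReal (measure_ne_top cantorMeasure _)).comp
    (tendsto_measure_iUnion_atTop (μ := cantorMeasure) hA)
  exact this.eventually (lt_mem_nhds h)

/-- A set of positive measure has relative measure more than `3 / 4` in some clopen set. -/
theorem exists_clopen_measureReal_inter_gt {P : Set (ℕ → Bool)}
    (hP : cantorMeasure P ≠ 0) : ∃ (L : ℕ) (F : List (List Bool)),
    3 / 4 * cantorMeasure.real {Z | initialSegment Z L ∈ F} <
      cantorMeasure.real (P ∩ {Z | initialSegment Z L ∈ F}) := by
  classical
  have hpos : 0 < cantorMeasure.real P := by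
    rw [measureReal_def]
    exact ENNReal.toReal_pos hP (measure_ne_top _ _)
  -- Outer regularity: `P` fills more than 3/4 of an open superset `U`.
  obtain ⟨U, hPU, hU, hUr⟩ := P.exists_isOpen_lt_of_lt (μ := cantorMeasure)
    (ENNReal.ofReal (4 / 3 * cantorMeasure.real P)) (by
      rw [ENNReal.lt_ofReal_iff_toReal_lt (measure_ne_top _ _), ← measureReal_def]
      linarith)
  have hUr' : cantorMeasure.real U < 4 / 3 * cantorMeasure.real P :=
    (ENNReal.lt_ofReal_iff_toReal_lt (measure_ne_top _ _)).1 hUr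
  -- The strings of length `s` whose cylinders lie inside `U`. These clopen sets increase and cover
  -- `P`, so a late one captures enough of it.
  let F : ℕ → List (List Bool) := fun s =>
    (binaryStrings s).filter fun ρ => ∀ Z, initialSegment Z s = ρ → Z ∈ U
  have hF : ∀ s Z, initialSegment Z s ∈ F s ↔
      ∀ Z', initialSegment Z' s = initialSegment Z s → Z' ∈ U := by
    intro s Z
    simp [F, mem_binaryStrings, length_initialSegment]
  have hmono : Monotone fun s => P ∩ {Z | initialSegment Z s ∈ F s} := by
    refine fun s t hst => Set.inter_subset_inter_right P fun Z hZ => (hF t Z).2 fun Z' hZ' => ?_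
    refine (hF s Z).1 hZ Z' ?_
    rw [← take_initialSegment Z' hst, ← take_initialSegment Z hst, hZ']
  have hUn : P ⊆ ⋃ s, P ∩ {Z | initialSegment Z s ∈ F s} := by
    intro Z hZ
    obtain ⟨_, ⟨Z₁, n, rfl⟩, hZn, hnU⟩ :=
      (PiNat.isTopologicalBasis_cylinders (fun _ => Bool)).exists_subset_of_mem_open (hPU hZ) hU
    refine Set.mem_iUnion.2 ⟨n, hZ, (hF n Z).2 fun Z' hZ' => hnU ?_⟩
    intro i hi
    have h := congrArg (fun l => l[i]?) hZ'
    simp only [getElem?_initialSegment hi, Option.some.injEq] at h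
    rw [h]
    exact hZn i hi
  obtain ⟨s, hs⟩ := (exists_lt_measureReal_of_iUnion hmono
    (r := 3 / 4 * cantorMeasure.real U) (lt_of_lt_of_le (by linarith)
      (measureReal_mono hUn))).exists
  refine ⟨s, F s, lt_of_le_of_lt ?_ hs⟩
  have : cantorMeasure.real {Z | initialSegment Z s ∈ F s} ≤ cantorMeasure.real U :=
    measureReal_mono fun Z hZ => (hF s Z).1 hZ Z rfl
  linarith

/-! ### Majority vote -/

/-- Computable choice between two semidecidable alternatives that cover all inputs. -/
theorem exists_computable_choice (S : Bool → ℕ → ℕ → Prop) (hS : ∀ v, PrimrecRel (S v))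
    (h : ∀ n, ∃ v j, S v n j) :
    ∃ D : ℕ → Bool, Computable D ∧ ∀ n, ∃ j, S (D n) n j := by
  classical
  -- Search both alternatives at once and take the first witness found; the preference for `true` in
  -- a tie is immaterial.
  let f : ℕ → ℕ → Option Bool := fun n j =>
    if S true n j then some true else if S false n j then some false else none
  have hf : Primrec₂ f :=
    Primrec.ite (hS true) (Primrec.const _)
      (Primrec.ite (hS false) (Primrec.const _) (Primrec.const _))
  have hfS : ∀ n j v, f n j = some v → S v n j := by
    intro n j v
    simp only [f]
    split_ifs with h1 h2 <;> simp only [Option.some.injEq, IsEmpty.forall_iff]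
    · rintro rfl
      exact h1
    · rintro rfl
      exact h2
  have hdom : ∀ n, (Nat.rfindOpt (f n)).Dom := by
    intro n
    obtain ⟨v, j, hv⟩ := h n
    refine Nat.rfindOpt_dom.2 ⟨j, ?_⟩
    by_cases h1 : S true n j
    · exact ⟨true, by simp [f, h1]⟩
    · cases v
      · exact ⟨false, by simp [f, h1, hv]⟩
      · exact (h1 hv).elim
  refine ⟨fun n => (Nat.rfindOpt (f n)).get (hdom n),
    (Partrec.rfindOpt hf.to_comp).of_eq_tot fun n => Part.get_mem _, fun n => ?_⟩
  obtain ⟨j, hj⟩ := Nat.rfindOpt_spec (Part.get_mem (hdom n))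
  exact ⟨j, hfS n j _ hj⟩

/-- The strings of length `L + j` above a string in `F` on which `c` gives output `v` on
input `n`. -/
def OracleCode.votes (c : OracleCode) (L : ℕ) (F : List (List Bool)) (v n j : ℕ) :
    List (List Bool) :=
  (binaryStrings (L + j)).filter fun ρ => ρ.take L ∈ F ∧ c.evalString ρ n = some v

theorem OracleCode.primrec_votes (c : OracleCode) (L : ℕ) (F : List (List Bool)) (v : ℕ) :
    Primrec₂ (c.votes L F v) := by
  have hF : PrimrecPred fun ρ : List Bool => ρ ∈ F :=
    ((PrimrecRel.exists_mem_list (R := fun a b : List Bool => a = b) Primrec.eq).comp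
      (Primrec.const F) Primrec.id).of_eq fun ρ => by simp
  have hR : PrimrecRel fun (ρ : List Bool) (n : ℕ) =>
      ρ.take L ∈ F ∧ c.evalString ρ n = some v :=
    PrimrecPred.and (hF.comp (Primrec.list_take.comp (Primrec.const L) Primrec.fst))
      (Primrec.eq.comp c.primrec_evalString (Primrec.const (some v)))
  exact hR.listFilter.comp (primrec_binaryStrings.comp
    (Primrec.nat_add.comp (Primrec.const L) Primrec.snd)) Primrec.fst

theorem OracleCode.measureReal_votes (c : OracleCode) (L : ℕ) (F : List (List Bool))
    (v n j : ℕ) :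
    cantorMeasure.real {Z | initialSegment Z L ∈ F ∧
      c.evalString (initialSegment Z (L + j)) n = some v} =
      (c.votes L F v n j).length / 2 ^ (L + j) := by
  rw [OracleCode.votes, ← cantorMeasure_setOf_initialSegment]
  simp [take_initialSegment]

theorem OracleCode.isOpen_mem_eval (c : OracleCode) (n v : ℕ) :
    IsOpen {Z | v ∈ c.eval (CoarseDegrees.oracle Z) n} := by
  have : {Z | v ∈ c.eval (CoarseDegrees.oracle Z) n} =
      ⋃ s, {Z | c.evalString (initialSegment Z s) n = some v} := by
    ext Z
    simp only [Set.mem_ofPred_eq, Set.mem_iUnion]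
    exact ⟨fun h => (c.eventually_evalString Z h).exists,
      fun ⟨s, hs⟩ => c.mem_eval_of_evalString Z s hs⟩
  rw [this]
  exact isOpen_iUnion fun s =>
    isOpen_setOf_initialSegment (fun σ => c.evalString σ n = some v) s

/-- A computation that succeeds on a set of oracles succeeds on almost all of it with a bounded
use. -/
theorem OracleCode.exists_lt_measureReal_evalString (c : OracleCode) (C : Set (ℕ → Bool))
    (n v : ℕ) {r : ℝ}
    (h : r < cantorMeasure.real {Z | Z ∈ C ∧ v ∈ c.eval (CoarseDegrees.oracle Z) n}) (L : ℕ) :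
    ∃ j, r < cantorMeasure.real
      {Z | Z ∈ C ∧ c.evalString (initialSegment Z (L + j)) n = some v} := by
  -- Demanding the value at every length from `t` on makes `B` increasing without a monotonicity
  -- lemma for `evalString`.
  let B : ℕ → Set (ℕ → Bool) := fun t =>
    {Z | Z ∈ C ∧ ∀ s ≥ t, c.evalString (initialSegment Z s) n = some v}
  have hB : Monotone B := fun s t hst Z hZ => ⟨hZ.1, fun u hu => hZ.2 u (hst.trans hu)⟩
  have hU : {Z | Z ∈ C ∧ v ∈ c.eval (CoarseDegrees.oracle Z) n} ⊆ ⋃ t, B t := by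
    rintro Z ⟨hZ, hv⟩
    obtain ⟨t, ht⟩ := eventually_atTop.1 (c.eventually_evalString Z hv)
    exact Set.mem_iUnion.2 ⟨t, hZ, ht⟩
  obtain ⟨j, hj⟩ := (exists_lt_measureReal_of_iUnion hB
    (h.trans_le (measureReal_mono hU))).exists
  exact ⟨j, hj.trans_le (measureReal_mono fun Z hZ => ⟨hZ.1, hZ.2 _ (by omega)⟩)⟩

/-! ### Averaging errors over oracles. -/

theorem densityBelow_eq_sum (S : Set ℕ) (m : ℕ) :
    densityBelow S m = (∑ n ∈ Finset.range m, S.indicator (fun _ => (1 : ℝ)) n) / m := by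
  classical
  unfold densityBelow
  have hS : S ∩ Set.Iio m = ((Finset.range m).filter (· ∈ S) : Finset ℕ) := by
    ext n
    simp [and_comm]
  rw [hS, Set.ncard_coe_finset]
  simp [Set.indicator_apply]

/-- If for every `Z ∈ G` the set of `n` with `Z ∈ Bad n` has density `0`, then by dominated
convergence the averages of the measures of the sets `Bad n ⊆ G` tend to `0`. -/
theorem tendsto_average_measureReal {G : Set (ℕ → Bool)} {Bad : ℕ → Set (ℕ → Bool)}
    (hBad : ∀ n, MeasurableSet (Bad n)) (hG : ∀ Z ∈ G, HasDensity {n | Z ∈ Bad n} 0)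
    (hsub : ∀ n, Bad n ⊆ G) :
    Tendsto (fun m : ℕ => (∑ n ∈ Finset.range m, cantorMeasure.real (Bad n)) / m) atTop (𝓝 0) := by
  let g : ℕ → (ℕ → Bool) → ℝ := fun m Z => densityBelow {n | Z ∈ Bad n} m
  have hg : ∀ m Z, g m Z =
      (∑ n ∈ Finset.range m, (Bad n).indicator (fun _ => (1 : ℝ)) Z) / m := fun m Z => by
    simp only [g, densityBelow_eq_sum]
    rfl
  have hint : ∀ m, ∫ Z, g m Z ∂cantorMeasure =
      (∑ n ∈ Finset.range m, cantorMeasure.real (Bad n)) / m := by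
    intro m
    simp only [hg]
    rw [integral_div, integral_finsetSum _ fun n _ =>
      (integrable_const (1 : ℝ)).indicator (hBad n)]
    simp [integral_indicator_const, hBad]
  have hmeas : ∀ m, AEStronglyMeasurable (g m) cantorMeasure := by
    intro m
    have : g m = fun Z => (∑ n ∈ Finset.range m, (Bad n).indicator (fun _ => (1 : ℝ)) Z) / m :=
      funext (hg m)
    rw [this]
    exact ((Finset.measurable_fun_sum _ fun n _ =>
      (measurable_const.indicator (hBad n))).div_const _).aestronglyMeasurable
  have hbound : ∀ m Z, ‖g m Z‖ ≤ 1 := by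
    intro m Z
    rw [Real.norm_of_nonneg (by simp only [g, densityBelow]; positivity), hg]
    refine div_le_one_of_le₀ ?_ (Nat.cast_nonneg m)
    refine (Finset.sum_le_card_nsmul _ _ 1 fun n _ => ?_).trans (by simp)
    exact Set.indicator_le_self' (fun _ _ => zero_le_one) _
  have hlim : ∀ Z, Tendsto (fun m => g m Z) atTop (𝓝 0) := by
    intro Z
    by_cases hZ : Z ∈ G
    · exact hG Z hZ
    · have : ∀ n, Z ∉ Bad n := fun n hn => hZ (hsub n hn)
      simp [g, this, densityBelow]
  have := tendsto_integral_of_dominated_convergence (μ := cantorMeasure) (F := g) (f := fun _ => 0)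
    (fun _ => 1) hmeas (integrable_const _) (fun m => .of_forall (hbound m)) (.of_forall hlim)
  simpa [hint] using this

/-- If a functional produces coarse descriptions of `E` on a set of oracles of positive measure,
then `E` is coarsely computable. -/
theorem coarselyComputable_of_measure_ne_zero (c : OracleCode) (E : ℕ → Bool)
    (hmeas : MeasurableSet (coarseDescriptionClass c E))
    (hpos : cantorMeasure (coarseDescriptionClass c E) ≠ 0) : CoarselyComputable E := by
  obtain ⟨L, F, hLF⟩ := exists_clopen_measureReal_inter_gt hpos
  set P := coarseDescriptionClass c E with hP
  set C := {Z | initialSegment Z L ∈ F} with hC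
  have hCm : MeasurableSet C := measurableSet_setOf_initialSegment (· ∈ F) L
  have hμC : cantorMeasure.real C =
      ((binaryStrings L).filter (· ∈ F)).length / 2 ^ L := by
    rw [← cantorMeasure_setOf_initialSegment]
    simp [hC]
  set K := ((binaryStrings L).filter (· ∈ F)).length
  -- The vote for `v` reaches 3/8 of the measure `K / 2 ^ L` of `C`, with denominators cleared so
  -- that the test is primitive recursive.
  let S : Bool → ℕ → ℕ → Prop := fun v n j =>
    3 * K * 2 ^ j ≤ 8 * (c.votes L F v.toNat n j).length
  have hSiff : ∀ v n j, S v n j ↔ 3 / 8 * cantorMeasure.real C ≤ cantorMeasure.real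
      {Z | Z ∈ C ∧ c.evalString (initialSegment Z (L + j)) n = some v.toNat} := by
    intro v n j
    have h1 := c.measureReal_votes L F v.toNat n j
    simp only [hC, Set.mem_ofPred_eq] at hμC ⊢
    rw [h1, hμC, pow_add, ← div_div, le_div_iff₀ (by positivity), ← mul_div_assoc,
      div_mul_eq_mul_div, div_le_div_iff_of_pos_right (by positivity)]
    simp only [S]
    rw [← Nat.cast_le (α := ℝ)]
    push_cast
    constructor <;> intro h <;> linarith
  have hSprim : ∀ v, PrimrecRel (S v) := by
    intro v
    have hpow : Primrec fun j : ℕ => 2 ^ j :=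
      (Primrec.nat_rec₁ 1 (f := fun _ x => 2 * x) (Primrec.nat_double.comp Primrec.snd).to₂).of_eq
        fun j => by
          induction j with
          | zero => rfl
          | succ j ih =>
            rw [pow_succ', ← ih]
    exact Primrec.nat_le.comp
      (Primrec.nat_mul.comp (Primrec.const (3 * K)) (hpow.comp Primrec.snd))
      (Primrec.nat_mul.comp (Primrec.const 8)
        (Primrec.list_length.comp (c.primrec_votes L F v.toNat)))
  -- Oracles in `P ∩ C`, more than 3/4 of `C`, all answer 0 or 1, so one answer has more than 3/8.
  have hSex : ∀ n, ∃ v j, S v n j := by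
    intro n
    let A : Bool → Set (ℕ → Bool) := fun v =>
      {Z | Z ∈ C ∧ v.toNat ∈ c.eval (oracle Z) n}
    have hsub : P ∩ C ⊆ A false ∪ A true := by
      rintro Z ⟨⟨D, hD, -⟩, hZ⟩
      have := toNat_mem_of_eval_eq hD n
      rcases h : D n
      · exact Or.inl ⟨hZ, h ▸ this⟩
      · exact Or.inr ⟨hZ, h ▸ this⟩
    have hle := (measureReal_mono (μ := cantorMeasure) hsub).trans (measureReal_union_le _ _)
    obtain ⟨v, hv⟩ : ∃ v, 3 / 8 * cantorMeasure.real C < cantorMeasure.real (A v) := by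
      by_contra! h
      linarith [h false, h true]
    obtain ⟨j, hj⟩ := c.exists_lt_measureReal_evalString C n v.toNat hv L
    exact ⟨v, j, (hSiff v n j).2 hj.le⟩
  obtain ⟨D, hDc, hD⟩ := exists_computable_choice S hSprim hSex
  refine ⟨D, hDc, ?_⟩
  let Bad : ℕ → Set (ℕ → Bool) := fun n =>
    (P ∩ C) ∩ {Z | (!E n).toNat ∈ c.eval (oracle Z) n}
  have hBadm : ∀ n, MeasurableSet (Bad n) := fun n =>
    (hmeas.inter hCm).inter (c.isOpen_mem_eval n _).measurableSet
  have hBadG : ∀ Z ∈ P ∩ C, HasDensity {n | Z ∈ Bad n} 0 := by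
    rintro Z ⟨⟨D', hD', hDE⟩, hZ⟩
    have h : {n | Z ∈ Bad n} = {n | D' n ≠ E n} := by
      ext n
      have : Z ∈ P ∩ C := ⟨⟨D', hD', hDE⟩, hZ⟩
      simp only [Bad, Set.mem_ofPred_eq, Set.mem_inter_iff, this.1, this.2, true_and, hD', oracle,
        Part.mem_some_iff]
      cases E n <;> cases D' n <;> simp
    rw [h]
    exact hDE
  have hCpos : 0 < cantorMeasure.real C := by
    rcases measureReal_nonneg (μ := cantorMeasure) (s := C) |>.lt_or_eq with h | h
    · exact h
    · have := measureReal_mono (μ := cantorMeasure) (Set.inter_subset_right : P ∩ C ⊆ C)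
      linarith
  -- Of the 3/8 of `C` voting wrongly, less than 1/4 lies outside `P`.
  have hwrong : ∀ n, D n ≠ E n → 1 / 8 * cantorMeasure.real C ≤ cantorMeasure.real (Bad n) := by
    intro n hn
    obtain ⟨j, hj⟩ := hD n
    rw [hSiff, show D n = !E n by revert hn; cases D n <;> cases E n <;> simp] at hj
    have hsub : {Z | Z ∈ C ∧ c.evalString (initialSegment Z (L + j)) n = some (!E n).toNat} ⊆
        Bad n ∪ C \ (P ∩ C) := by
      rintro Z ⟨hZ, hv⟩
      by_cases hZP : Z ∈ P
      · exact Or.inl ⟨⟨hZP, hZ⟩, c.mem_eval_of_evalString Z _ hv⟩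
      · exact Or.inr ⟨hZ, fun h => hZP h.1⟩
    have h1 := (measureReal_mono (μ := cantorMeasure) hsub).trans (measureReal_union_le _ _)
    rw [measureReal_sdiff Set.inter_subset_right (hmeas.inter hCm)] at h1
    linarith
  -- Scaled by `8 / μ(C)`, each error of `D` is charged at most the measure of its bad set, as in
  -- Markov's inequality.
  have hlim := (tendsto_average_measureReal hBadm hBadG
    fun n => Set.inter_subset_left).const_mul (8 / cantorMeasure.real C)
  rw [mul_zero] at hlim
  refine squeeze_zero (fun m => by unfold densityBelow; positivity) (fun m => ?_) hlim
  rw [densityBelow_eq_sum, ← mul_div_assoc, Finset.mul_sum]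
  gcongr with n
  by_cases hn : D n = E n
  · rw [Set.indicator_of_notMem (by simpa using hn)]
    positivity
  · rw [Set.indicator_of_mem (by simpa using hn), div_mul_eq_mul_div, le_div_iff₀ hCpos]
    linarith [hwrong n hn]

/-! ### Coarse descriptions of a fixed set form a null class -/

theorem cantorMeasure_coordinate (i : ℕ) (b : Bool) : cantorMeasure.real {Z | Z i = b} = 1 / 2 := by
  have h : {Z : ℕ → Bool | Z i = b} = Set.pi (({i} : Finset ℕ) : Set ℕ) fun _ => {b} := by
    ext Z
    simp
  rw [h, measureReal_def, cantorMeasure, Measure.infinitePi_pi _ fun _ _ => .singleton _]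
  simp

/-- The strong law of large numbers for the disagreements with a fixed set. -/
theorem ae_hasDensity_disagreement (E : ℕ → Bool) :
    ∀ᵐ Z ∂cantorMeasure, HasDensity {n | Z n ≠ E n} (1 / 2) := by
  let h : Bool → ℝ := fun b => if b then 1 else 0
  -- The disagreement bits; flipping fair coins by the fixed `E` leaves them independent and fair.
  let W : ℕ → (ℕ → Bool) → Bool := fun i Z => xor (Z i) (E i)
  let V : ℕ → (ℕ → Bool) → ℝ := fun i Z => h (W i Z)
  have hh : Measurable h := measurable_of_finite h
  have hW : ∀ i, Measurable (W i) := fun i =>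
    (measurable_of_finite fun b => xor b (E i)).comp (measurable_pi_apply i)
  have hWb : ∀ i b, cantorMeasure (W i ⁻¹' {b}) = ENNReal.ofReal (1 / 2) := by
    intro i b
    rw [← cantorMeasure_coordinate i (xor b (E i)), measureReal_def,
      ENNReal.ofReal_toReal (measure_ne_top _ _)]
    congr 1
    ext Z
    simp only [W, Set.mem_preimage, Set.mem_singleton_iff, Set.mem_ofPred_eq]
    cases Z i <;> cases E i <;> cases b <;> simp
  have hident : ∀ i, ProbabilityTheory.IdentDistrib (V i) (V 0) cantorMeasure cantorMeasure := by
    intro i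
    have : ProbabilityTheory.IdentDistrib (W i) (W 0) cantorMeasure cantorMeasure := by
      refine ⟨(hW i).aemeasurable, (hW 0).aemeasurable, Measure.ext_of_singleton fun b => ?_⟩
      rw [Measure.map_apply (hW i) (.singleton b), Measure.map_apply (hW 0) (.singleton b),
        hWb, hWb]
    exact this.comp hh
  have hindep : ProbabilityTheory.iIndepFun V cantorMeasure :=
    ProbabilityTheory.iIndepFun_infinitePi (X := fun i b => h (xor b (E i)))
      fun i => measurable_of_finite _
  have hV : V 0 = (W 0 ⁻¹' {true}).indicator fun _ => 1 := by
    ext Z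
    by_cases hZ : W 0 Z = true
    · rw [Set.indicator_of_mem (show Z ∈ W 0 ⁻¹' {true} from hZ)]
      simp [V, h, hZ]
    · rw [Set.indicator_of_notMem (show Z ∉ W 0 ⁻¹' {true} from hZ)]
      simp [V, h, hZ]
  have hWm : MeasurableSet (W 0 ⁻¹' {true}) := hW 0 (.singleton true)
  have hint : Integrable (V 0) cantorMeasure := by
    rw [hV]
    exact (integrable_const 1).indicator hWm
  have hmean : ∫ Z, V 0 Z ∂cantorMeasure = 1 / 2 := by
    rw [hV, integral_indicator_const _ hWm, measureReal_def, hWb]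
    norm_num
  filter_upwards [ProbabilityTheory.strong_law_ae_real V hint
    (fun i j hij => hindep.indepFun hij) hident] with Z hZ
  rw [hmean] at hZ
  refine hZ.congr fun m => ?_
  rw [densityBelow_eq_sum]
  congr 1
  refine Finset.sum_congr rfl fun n _ => ?_
  by_cases hn : Z n = E n
  · rw [Set.indicator_of_notMem (by simpa using hn)]
    simp [V, h, W, hn]
  · rw [Set.indicator_of_mem (by simpa using hn)]
    simp [V, h, W, hn]

theorem cantorMeasure_isCoarseDescription (E : ℕ → Bool) :
    cantorMeasure {Z | IsCoarseDescription Z E} = 0 := by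
  refine measure_mono_null (fun Z hZ => ?_) (ae_iff.1 (ae_hasDensity_disagreement E))
  intro h
  have := tendsto_nhds_unique h hZ
  norm_num at this

/-! ### Minimal pairs -/

theorem computes_of_computable {D : ℕ → Bool} (hD : Computable D) (Y : ℕ → Bool) :
    Computes Y D :=
  ((Primrec.dom_bool Bool.toNat).to_comp.comp hD).computableIn

theorem computable_of_computes_empty {D : ℕ → Bool} (h : Computes (fun _ => false) D) :
    Computable D := by
  have hp : Computable fun n => (D n).toNat := h.partrec_of_const
  have : Computable fun n => decide ((D n).toNat = 1) :=
    ((Primrec.eq.comp Primrec.id (Primrec.const 1)).decide).to_comp.comp hp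
  exact this.of_eq fun n => by cases D n <;> rfl

theorem nonuniformCoarseReducible_empty_iff (A : ℕ → Bool) :
    NonuniformCoarseReducible A (fun _ => false) ↔ CoarselyComputable A := by
  constructor
  · intro h
    obtain ⟨E, hE, hc⟩ := h _ (.refl _)
    exact ⟨E, computable_of_computes_empty hc, hE⟩
  · rintro ⟨D, hD, hDA⟩ Z -
    exact ⟨D, hDA, computes_of_computable hD Z⟩

theorem uniformCoarseReducible_empty_iff (A : ℕ → Bool) :
    UniformCoarseReducible A (fun _ => false) ↔ CoarselyComputable A := by
  constructor
  · exact fun h => (nonuniformCoarseReducible_empty_iff A).1 h.nonuniform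
  · rintro ⟨D, hD, hDA⟩
    have hp : Partrec fun n => Part.some (D n).toNat :=
      (Primrec.dom_bool Bool.toNat).to_comp.comp hD
    obtain ⟨c, hc⟩ := (OracleCode.exists_eval_iff (fun _ => Part.none) (oracle D)).2
      (Partrec.recursiveIn hp)
    -- The search `.rfind .succ` never halts, so every query gets the answer of the nowhere defined
    -- oracle and the result does not depend on `Z`.
    refine ⟨c.subst (.rfind .succ), fun Z _ => ⟨D, hDA, ?_⟩⟩
    rw [OracleCode.eval_subst, ← hc]
    congr 1
    funext n
    refine Part.eq_none_iff.2 fun m hm => ?_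
    have := (Nat.mem_rfind.1 hm).1
    simp [OracleCode.eval] at this

/-- With the identity functional, the coarse descriptions of a computable `C` form a null `Π⁰₃`
class relative to any `Y`, so it cannot contain `X`. -/
theorem WeaklyThreeRandomRel.not_coarselyComputable {X Y : ℕ → Bool}
    (hX : WeaklyThreeRandomRel X Y) : ¬ CoarselyComputable X := by
  rintro ⟨C, hC, hCX⟩
  have h : coarseDescriptionClass .oracle C = {Z | IsCoarseDescription Z C} := by
    ext Z
    constructor
    · rintro ⟨D, hD, hDC⟩
      have : Z = D := funext fun n => by
        have := Part.some_injective (congrFun hD n)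
        revert this
        cases Z n <;> cases D n <;> simp
      exact this ▸ hDC
    · exact fun hZ => ⟨Z, rfl, hZ⟩
  exact hX _ (isPiThreeClassRel_coarseDescriptionClass .oracle (computes_of_computable hC Y))
    (h ▸ cantorMeasure_isCoarseDescription C) ⟨X, rfl, hCX.symm⟩

theorem WeaklyThreeRandomRel.coarselyComputable_of_reducible {X Y A : ℕ → Bool}
    (hX : WeaklyThreeRandomRel X Y) (hAX : NonuniformCoarseReducible A X)
    (hAY : NonuniformCoarseReducible A Y) : CoarselyComputable A := by
  -- Only the descriptions of `X` and `Y` by themselves are used.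
  obtain ⟨D, hDA, hXD⟩ := hAX X (.refl X)
  obtain ⟨E, hEA, hYE⟩ := hAY Y (.refl Y)
  obtain ⟨c, hc⟩ := (OracleCode.exists_eval_iff _ _).2 hXD
  have hclass := isPiThreeClassRel_coarseDescriptionClass c hYE
  obtain ⟨F, hF, hFE⟩ := coarselyComputable_of_measure_ne_zero c E hclass.measurableSet
    fun h0 => hX _ hclass h0 ⟨D, hc, hDA.trans hEA.symm⟩
  exact ⟨F, hF, hFE.trans hEA⟩

theorem nonuniformDegree_eq_bot_iff (A : ℕ → Bool) :
    nonuniformDegree A = ⊥ ↔ CoarselyComputable A :=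
  le_bot_iff.symm.trans (nonuniformCoarseReducible_empty_iff A)

theorem uniformDegree_eq_bot_iff (A : ℕ → Bool) :
    uniformDegree A = ⊥ ↔ CoarselyComputable A :=
  le_bot_iff.symm.trans (uniformCoarseReducible_empty_iff A)

end CoarseDegrees

theorem mainTheorem9 (X Y : ℕ → Bool)
    (hY : ¬ CoarseDegrees.CoarselyComputable Y)
    (hX : CoarseDegrees.WeaklyThreeRandomRel X Y) :
    CoarseDegrees.IsMinimalPair
        (CoarseDegrees.nonuniformDegree X) (CoarseDegrees.nonuniformDegree Y) ∧
      CoarseDegrees.IsMinimalPair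
        (CoarseDegrees.uniformDegree X) (CoarseDegrees.uniformDegree Y) := by
  refine ⟨⟨?_, ?_, fun a => ?_⟩, ?_, ?_, fun a => ?_⟩
  · exact fun h => hX.not_coarselyComputable ((CoarseDegrees.nonuniformDegree_eq_bot_iff X).1 h)
  · exact fun h => hY ((CoarseDegrees.nonuniformDegree_eq_bot_iff Y).1 h)
  · refine Quotient.inductionOn' a fun A hAX hAY => ?_
    exact (CoarseDegrees.nonuniformDegree_eq_bot_iff A).2
      (hX.coarselyComputable_of_reducible hAX hAY)
  · exact fun h => hX.not_coarselyComputable ((CoarseDegrees.uniformDegree_eq_bot_iff X).1 h)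
  · exact fun h => hY ((CoarseDegrees.uniformDegree_eq_bot_iff Y).1 h)
  · refine Quotient.inductionOn' a fun A hAX hAY => ?_
    exact (CoarseDegrees.uniformDegree_eq_bot_iff A).2
      (hX.coarselyComputable_of_reducible
        (CoarseDegrees.UniformCoarseReducible.nonuniform hAX)
        (CoarseDegrees.UniformCoarseReducible.nonuniform hAY))
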